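/- A physical quantity is one of the numerical Lie groups $\{\mathbb R,+\}$, $\{e^{i\mathbb R},\cdot\}$, $\{\mathbb Z,+\}$, $\{e^{2\pi i\mathbb Z/N},\cdot\}$ $(N\ge 1)$; its dual quantity $\hat G$ is, respectively, $\mathbb R$, $\mathbb Z$, $e^{i\mathbb R}$, $e^{2\pi i\mathbb Z/N}$. Write $\chi(G)$ for the topological group of continuous characters $G\to e^{i\mathbb R}$. Let $\mathcal H$ be a separable complex Hilbert space. An observable is a (possibly unbounded) self-adjoint or a unitary operator in $\mathcal H$. SCU means strongly continuous unitary. A canonical system $\{G,\pi,T,\hat G,\breve\pi,\breve T\}$ consists of a physical quantity $G$, SCU representations $\pi$ of $G$ and $\breve\pi$ of $\hat G$ in $\mathcal H$, and operators $T,\breve T$ such that: (a) $T$ is a generator of $\pi$ in the following sense: if $G=\mathbb R$ or $G=e^{i\mathbb R}$, $T$ is the self-adjoint infinitesimal generator, that is $\pi(t)=e^{itT}$, respectively $\pi(e^{it})=e^{itT}$, for all $t\in\mathbb R$; if $G=\mathbb Z$ or $G=e^{2\pi i\mathbb Z/N}$, $T$ is an element of $\pi(G)$ that generates the group $\pi(G)$.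 In the same sense $\breve T$ is a generator of the representation $\breve\pi$ of $\hat G$. (b) $\mathrm{spec}(\breve T)=G$ and $\mathrm{spec}(T)=\hat G$ (as sets of complex numbers). (c) $\breve T$ is a canonical observable of $\pi$: it is an observable with $\pi(g)^*\breve T\pi(g)=g\bullet\breve T$ for all $g\in G$, including equality of domains, where $g\bullet\breve T=\breve T+gI$ if $G$ is $\mathbb R$ or $\mathbb Z$, and $g\bullet\breve T=g\breve T$ if $G$ is $e^{i\mathbb R}$ or $e^{2\pi i\mathbb Z/N}$. The Heisenberg group $J$ of $G$ is the group of unitary operators $e^{2\pi it}L(k)M(\chi)$ on $L^2(G)$ (Haar measure), $t\in[0,1)$, $k\in G$, $\chi\in\chi(G)$, where $L(k)f(x)=f(k^{-1}\bullet x)$ and $M(\chi)f(x)=\chi(x)f(x)$, with the topology of the coordinates $(e^{2\pi it},k,\chi)\in e^{i\mathbb R}\times G\times\chi(G)$. **Proposition.** Let $\{G,\pi,T,\hat G,\breve\pi,\breve T\}$ be a canonical system. Then there exists an isomorphism of topological groups $$\hat G\to\chi(G),\qquad \hat g\mapsto\chi_{\hat g},$$ such that $$\pi(g)^*\breve\pi(\hat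 g)^*\pi(g)\breve\pi(\hat g)=\overline{\chi_{\hat g}(g)}\,I\qquad\text{for all } g\in G,\ \hat g\in\hat G,$$ and such that the Schrödinger representation $$\Pi\big(e^{2\pi it}L(g)M(\chi_{\hat g})\big)=e^{2\pi it}\pi(g)\breve\pi(\hat g),\qquad t\in[0,1),\ g\in G,\ \hat g\in\hat G,$$ is a well-defined SCU representation of $J$ in $\mathcal H$. -/

import Mathlib

open MeasureTheory Filter Topology
open scoped ENNReal ComplexConjugate

noncomputable section

/-! ### Physical quantities -/

/-- The numerical Lie groups `{ℝ,+}`, `{e^{iℝ},·}`, `{ℤ,+}` and `{e^{2πiℤ/N},·}` with `N ≥ 1`. -/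
inductive PhysicalQuantity where
  | real
  | circle
  | int
  | roots (N : ℕ+)

namespace PhysicalQuantity

/-- The underlying group, written multiplicatively. -/
def Carrier : PhysicalQuantity → Type
  | real => Multiplicative ℝ
  | circle => Circle
  | int => Multiplicative ℤ
  | roots N => Subgroup.zpowers (Circle.exp (2 * Real.pi / N))

instance instCommGroup : (G : PhysicalQuantity) → CommGroup G.Carrier
  | real => inferInstanceAs (CommGroup (Multiplicative ℝ))
  | circle => inferInstanceAs (CommGroup Circle)
  | int => inferInstanceAs (CommGroup (Multiplicative ℤ))
  | roots N => inferInstanceAs (CommGroup (Subgroup.zpowers (Circle.exp (2 * Real.pi / N))))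

instance instTopologicalSpace : (G : PhysicalQuantity) → TopologicalSpace G.Carrier
  | real => inferInstanceAs (TopologicalSpace (Multiplicative ℝ))
  | circle => inferInstanceAs (TopologicalSpace Circle)
  | int => inferInstanceAs (TopologicalSpace (Multiplicative ℤ))
  | roots N => inferInstanceAs (TopologicalSpace (Subgroup.zpowers (Circle.exp (2 * Real.pi / N))))

instance instIsTopologicalGroup : (G : PhysicalQuantity) → IsTopologicalGroup G.Carrier
  | real => inferInstanceAs (IsTopologicalGroup (Multiplicative ℝ))
  | circle => inferInstanceAs (IsTopologicalGroup Circle)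
  | int => inferInstanceAs (IsTopologicalGroup (Multiplicative ℤ))
  | roots N =>
    inferInstanceAs (IsTopologicalGroup (Subgroup.zpowers (Circle.exp (2 * Real.pi / N))))

instance instLocallyCompactSpace : (G : PhysicalQuantity) → LocallyCompactSpace G.Carrier
  | real => inferInstanceAs (LocallyCompactSpace (Multiplicative ℝ))
  | circle => inferInstanceAs (LocallyCompactSpace Circle)
  | int => inferInstanceAs (LocallyCompactSpace (Multiplicative ℤ))
  | roots N => by
    have hfin : ((Subgroup.zpowers (Circle.exp (2 * Real.pi / N)) : Subgroup Circle) :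
        Set Circle).Finite := by
      have h1 : IsOfFinOrder (Circle.exp (2 * Real.pi / N)) := by
        refine isOfFinOrder_iff_pow_eq_one.2 ⟨N, N.pos, ?_⟩
        have hN : ((N : ℕ) : ℝ) ≠ 0 := by exact_mod_cast N.ne_zero
        have h2 := map_nsmul Circle.expHom (N : ℕ) (2 * Real.pi / (N : ℕ))
        have h3 : (N : ℕ) • (2 * Real.pi / ((N : ℕ) : ℝ)) = 2 * Real.pi := by
          rw [nsmul_eq_mul]; field_simp
        rw [h3] at h2
        have h4 : Circle.exp (2 * Real.pi) = Circle.exp (2 * Real.pi / (N : ℕ)) ^ (N : ℕ) := h2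
        rw [← h4, Circle.exp_two_pi]
      exact h1.finite_zpowers
    exact hfin.isCompact.isClosed.isClosedEmbedding_subtypeVal.locallyCompactSpace

instance instMeasurableSpace (G : PhysicalQuantity) : MeasurableSpace G.Carrier := borel _

instance instBorelSpace (G : PhysicalQuantity) : BorelSpace G.Carrier := ⟨rfl⟩

/-- The number that an element of a physical quantity is. -/
def val : (G : PhysicalQuantity) → G.Carrier → ℂ
  | real => fun x => ((Multiplicative.toAdd (α := ℝ) x : ℝ) : ℂ)
  | circle => fun z => ((show Circle from z) : ℂ)
  | int => fun n => ((Multiplicative.toAdd (α := ℤ) n : ℤ) : ℂ)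
  | roots N => fun z =>
      (((show Subgroup.zpowers (Circle.exp (2 * Real.pi / N)) from z) : Circle) : ℂ)

/-- The physical quantity `Ĝ` dual to `G`. -/
def dual : PhysicalQuantity → PhysicalQuantity
  | real => real
  | circle => int
  | int => circle
  | roots N => roots N

end PhysicalQuantity

/-! ### Operators on a Hilbert space -/

section Operators

variable {H : Type*} [NormedAddCommGroup H] [InnerProductSpace ℂ H] [CompleteSpace H]

/-- An everywhere defined operator as a partially defined one. -/
def unitaryPMap (U : unitary (H →L[ℂ] H)) : H →ₗ.[ℂ] H :=
  ((U : H →L[ℂ] H) : H →ₗ[ℂ] H).toPMap ⊤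

/-- An observable is a (possibly unbounded) self-adjoint operator or a unitary operator. -/
def IsObservable (T : H →ₗ.[ℂ] H) : Prop :=
  IsSelfAdjoint T ∨ ∃ U : unitary (H →L[ℂ] H), T = unitaryPMap U

/-- `c` is in the resolvent set of `T`: `T - c` maps its domain bijectively onto `H`, with
bounded inverse `R`. -/
def IsResolventPoint (T : H →ₗ.[ℂ] H) (c : ℂ) : Prop :=
  ∃ R : H →L[ℂ] H,
    (∀ y : H, ∃ x : T.domain, (x : H) = R y ∧ T x - c • (x : H) = y) ∧
    (∀ x : T.domain, R (T x - c • (x : H)) = x)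

/-- The spectrum of a possibly unbounded operator. -/
def spec (T : H →ₗ.[ℂ] H) : Set ℂ := {c | ¬ IsResolventPoint T c}

/-- The conjugated operator `U^* T U`, with domain `U⁻¹ (dom T)`. -/
def conjugate (U : unitary (H →L[ℂ] H)) (T : H →ₗ.[ℂ] H) : H →ₗ.[ℂ] H where
  domain := T.domain.comap ((U : H →L[ℂ] H) : H →ₗ[ℂ] H)
  toFun :=
    { toFun := fun x => (star U : H →L[ℂ] H) (T ⟨(U : H →L[ℂ] H) x, x.2⟩)
      map_add' := fun x y => by
        rw [← map_add, ← LinearPMap.map_add]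
        congr 2
        exact Subtype.ext (map_add (U : H →L[ℂ] H) (x : H) (y : H))
      map_smul' := fun c x => by
        rw [RingHom.id_apply, ← map_smul, ← LinearPMap.map_smul]
        congr 2
        exact Subtype.ext (map_smul (U : H →L[ℂ] H) c (x : H)) }

/-- The operator `g • T`: it is `T + gI` for the additive groups `ℝ`, `ℤ`, and `gT` for the
multiplicative groups `e^{iℝ}`, `e^{2πiℤ/N}`. -/
def PhysicalQuantity.act : (G : PhysicalQuantity) → G.Carrier → (H →ₗ.[ℂ] H) → (H →ₗ.[ℂ] H)
  | .real, g, T => (PhysicalQuantity.real.val g • (LinearMap.id : H →ₗ[ℂ] H)) +ᵥ T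
  | .circle, g, T => PhysicalQuantity.circle.val g • T
  | .int, g, T => (PhysicalQuantity.int.val g • (LinearMap.id : H →ₗ[ℂ] H)) +ᵥ T
  | .roots N, g, T => (PhysicalQuantity.roots N).val g • T

/-- A strongly continuous unitary (SCU) representation. -/
def IsSCU {K : Type*} [Group K] [TopologicalSpace K] (ρ : K →* unitary (H →L[ℂ] H)) : Prop :=
  ∀ f : H, Continuous fun k => (ρ k : H →L[ℂ] H) f

/-- `T` is the self-adjoint infinitesimal generator of the one-parameter family `V`, that is
`V t = e^{itT}`: a vector `f` is in the domain of `T`, with `T f = h`, if and only if `t ↦ V t f`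
has the derivative `i h` at `0`. -/
def IsInfinitesimalGenerator (T : H →ₗ.[ℂ] H) (V : ℝ → unitary (H →L[ℂ] H)) : Prop :=
  IsSelfAdjoint T ∧
  ∀ f h : H, (∃ x : T.domain, (x : H) = f ∧ T x = h) ↔
    HasDerivAt (fun t : ℝ => (V t : H →L[ℂ] H) f) (Complex.I • h) 0

/-- `T` is a unitary operator in `ρ(K)` that generates the group `ρ(K)`. -/
def IsUnitaryGenerator {K : Type*} [Group K] (T : H →ₗ.[ℂ] H)
    (ρ : K →* unitary (H →L[ℂ] H)) : Prop :=
  ∃ U : unitary (H →L[ℂ] H), T = unitaryPMap U ∧ Subgroup.zpowers U = ρ.range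

/-- `T` is a generator of `π(G)` (for the zero-dimensional groups `ℤ`, `e^{2πiℤ/N}`) or the
infinitesimal generator of `π` (for the one-dimensional groups: `π(t) = e^{itT}` for `ℝ`, and
`π(e^{it}) = e^{itT}` for `e^{iℝ}`). -/
def IsGenerator : (G : PhysicalQuantity) → (H →ₗ.[ℂ] H) →
    (G.Carrier →* unitary (H →L[ℂ] H)) → Prop
  | .real, T, π => IsInfinitesimalGenerator T fun t => π (Multiplicative.ofAdd (α := ℝ) t)
  | .circle, T, π => IsInfinitesimalGenerator T fun t => π (Circle.exp t)
  | .int, T, π => IsUnitaryGenerator T π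
  | .roots _, T, π => IsUnitaryGenerator T π

/-- `T` is a canonical observable of `π`: it is an observable with
`π(g)^* T π(g) = g • T` for all `g`. -/
def IsCanonicalObservable (G : PhysicalQuantity) (π : G.Carrier →* unitary (H →L[ℂ] H))
    (T : H →ₗ.[ℂ] H) : Prop :=
  IsObservable T ∧ ∀ g : G.Carrier, conjugate (π g) T = G.act g T

/-- `{G, π, T, Ĝ, π', T'}` is a canonical system. -/
structure IsCanonicalSystem (G : PhysicalQuantity) (π : G.Carrier →* unitary (H →L[ℂ] H))
    (T : H →ₗ.[ℂ] H) (π' : G.dual.Carrier →* unitary (H →L[ℂ] H)) (T' : H →ₗ.[ℂ] H) : Prop where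
  scu : IsSCU π
  scu_dual : IsSCU π'
  generator : IsGenerator G T π
  generator_dual : IsGenerator G.dual T' π'
  spec_dual : spec T' = Set.range G.val
  spec_eq : spec T = Set.range G.dual.val
  canonical : IsCanonicalObservable G π T'

/-- The scalar operator `z I`. -/
def scalarUnitary : Circle →* unitary (H →L[ℂ] H) where
  toFun z := ⟨(z : ℂ) • (1 : H →L[ℂ] H), by
    have h1 : conj (z : ℂ) * (z : ℂ) = 1 := by
      rw [mul_comm, Complex.mul_conj, Circle.normSq_coe]; simp
    rw [Unitary.mem_iff]
    constructor
    · rw [star_smul, star_one, smul_mul_smul_comm, one_mul, Complex.star_def, h1, one_smul]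
    · rw [star_smul, star_one, smul_mul_smul_comm, one_mul, Complex.star_def, mul_comm, h1,
        one_smul]⟩
  map_one' := by ext; simp
  map_mul' z w := by ext; simp [smul_smul, mul_comm]

theorem coe_scalarUnitary (z : Circle) :
    ((scalarUnitary z : unitary (H →L[ℂ] H)) : H →L[ℂ] H) = (z : ℂ) • 1 := rfl

theorem scalarUnitary_comm (z : Circle) (U : unitary (H →L[ℂ] H)) :
    scalarUnitary z * U = U * scalarUnitary z := by
  ext; simp [coe_scalarUnitary]

/-- A homomorphism from a group to isometric operators takes unitary values. -/
def unitaryOfIsometric {K : Type*} [Group K] (φ : K →* (H →L[ℂ] H))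
    (hφ : ∀ k f, ‖φ k f‖ = ‖f‖) : K →* unitary (H →L[ℂ] H) where
  toFun k := ⟨φ k, by
    have h1 : star (φ k) * φ k = 1 :=
      (ContinuousLinearMap.norm_map_iff_adjoint_comp_self (φ k)).1 (hφ k)
    have h2 : φ k * φ k⁻¹ = 1 := by rw [← map_mul, mul_inv_cancel, map_one]
    have h3 : star (φ k) = φ k⁻¹ := left_inv_eq_right_inv h1 h2
    rw [Unitary.mem_iff]
    exact ⟨h1, by rw [h3, h2]⟩⟩
  map_one' := Subtype.ext (map_one φ)
  map_mul' a b := Subtype.ext (map_mul φ a b)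

end Operators

/-! ### The Heisenberg group of a locally compact abelian group -/

section Heisenberg

variable (K : Type*) [CommGroup K] [TopologicalSpace K] [IsTopologicalGroup K]
  [LocallyCompactSpace K] [MeasurableSpace K] [BorelSpace K]

/-- `L²(K)` with respect to the Haar measure. -/
abbrev L2Haar : Type _ := Lp ℂ 2 (Measure.haar : Measure K)

variable {K}

/-- The translations `L(k) f (t) = f (k⁻¹ t)`. -/
def translationOp : K →* unitary (L2Haar K →L[ℂ] L2Haar K) :=
  unitaryOfIsometric
    { toFun := fun k => (Lp.compMeasurePreservingₗᵢ ℂ (fun t : K => k⁻¹ * t)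
        (measurePreserving_mul_left Measure.haar k⁻¹)).toContinuousLinearMap
      map_one' := by
        ext f
        have h := Lp.coeFn_compMeasurePreserving f
          (measurePreserving_mul_left (Measure.haar : Measure K) (1 : K)⁻¹)
        refine h.trans (Eventually.of_forall fun t => ?_)
        simp
      map_mul' := fun a b => by
        ext f
        have h1 := Lp.coeFn_compMeasurePreserving f
          (measurePreserving_mul_left (Measure.haar : Measure K) (a * b)⁻¹)
        have h2 := Lp.coeFn_compMeasurePreserving f
          (measurePreserving_mul_left (Measure.haar : Measure K) b⁻¹)
        have h3 := Lp.coeFn_compMeasurePreserving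
          (Lp.compMeasurePreserving _
            (measurePreserving_mul_left (Measure.haar : Measure K) b⁻¹) f)
          (measurePreserving_mul_left (Measure.haar : Measure K) a⁻¹)
        have h4 := (measurePreserving_mul_left (Measure.haar : Measure K)
          a⁻¹).quasiMeasurePreserving.ae_eq_comp h2
        refine h1.trans (EventuallyEq.symm (h3.trans (h4.trans ?_)))
        refine Eventually.of_forall fun t => ?_
        simp [mul_assoc] }
    (fun k f => Lp.norm_compMeasurePreserving f
      (measurePreserving_mul_left (Measure.haar : Measure K) k⁻¹))

theorem coeFn_translationOp (k : K) (f : L2Haar K) :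
    ⇑((translationOp k : L2Haar K →L[ℂ] L2Haar K) f) =ᵐ[Measure.haar] fun t => f (k⁻¹ * t) :=
  Lp.coeFn_compMeasurePreserving f
    (measurePreserving_mul_left (Measure.haar : Measure K) k⁻¹)

theorem memLp_char_mul (χ : PontryaginDual K) (f : L2Haar K) :
    MemLp (fun t => (χ t : ℂ) * f t) 2 (Measure.haar : Measure K) := by
  have hc : Continuous fun t : K => (χ t : ℂ) := continuous_subtype_val.comp (map_continuous χ)
  refine (Lp.memLp f).congr_norm
    (hc.aestronglyMeasurable.mul (Lp.aestronglyMeasurable f)) (Eventually.of_forall fun t => ?_)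
  rw [norm_mul, Circle.norm_coe, one_mul]

/-- The modulations `M(χ) f (t) = χ(t) f (t)`. -/
def modulationOp : PontryaginDual K →* unitary (L2Haar K →L[ℂ] L2Haar K) :=
  unitaryOfIsometric
    { toFun := fun χ => LinearMap.mkContinuous
        { toFun := fun f => (memLp_char_mul χ f).toLp
          map_add' := fun f g => by
            rw [← MemLp.toLp_add, MemLp.toLp_eq_toLp_iff]
            filter_upwards [Lp.coeFn_add f g] with t ht
            rw [ht, Pi.add_apply, Pi.add_apply, mul_add]
          map_smul' := fun c f => by
            rw [RingHom.id_apply, ← MemLp.toLp_const_smul, MemLp.toLp_eq_toLp_iff]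
            filter_upwards [Lp.coeFn_smul c f] with t ht
            simp [ht]
            ring } 1
        (fun f => by
          rw [one_mul]
          refine Lp.norm_le_norm_of_ae_le ?_
          filter_upwards [(memLp_char_mul χ f).coeFn_toLp] with t ht
          refine le_of_eq ((congrArg norm ht).trans ?_)
          rw [norm_mul, Circle.norm_coe, one_mul])
      map_one' := by
        ext f
        refine (memLp_char_mul 1 f).coeFn_toLp.trans (Eventually.of_forall fun t => ?_)
        simp
      map_mul' := fun χ η => by
        ext f
        have h1 := (memLp_char_mul (χ * η) f).coeFn_toLp
        have h2 := (memLp_char_mul η f).coeFn_toLp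
        have h3 := (memLp_char_mul χ ((memLp_char_mul η f).toLp)).coeFn_toLp
        refine h1.trans (EventuallyEq.symm (h3.trans ?_))
        filter_upwards [h2] with t ht
        rw [ht]
        change _ = (((χ t * η t : Circle)) : ℂ) * _
        rw [Circle.coe_mul, mul_assoc] }
    (fun χ f => by
      refine le_antisymm (Lp.norm_le_norm_of_ae_le ?_) (Lp.norm_le_norm_of_ae_le ?_) <;>
      · filter_upwards [(memLp_char_mul χ f).coeFn_toLp] with t ht
        have e := (congrArg norm ht).trans
          (show ‖(χ t : ℂ) * f t‖ = ‖f t‖ by rw [norm_mul, Circle.norm_coe, one_mul])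
        first | exact e.le | exact e.ge)

theorem coeFn_modulationOp (χ : PontryaginDual K) (f : L2Haar K) :
    ⇑((modulationOp χ : L2Haar K →L[ℂ] L2Haar K) f) =ᵐ[Measure.haar]
      fun t => (χ t : ℂ) * f t :=
  (memLp_char_mul χ f).coeFn_toLp

theorem modulationOp_mul_translationOp (χ : PontryaginDual K) (k : K) :
    modulationOp χ * translationOp k =
      scalarUnitary (χ k) * translationOp k * modulationOp χ := by
  ext f
  have h1 := coeFn_translationOp k f
  have h2 := coeFn_modulationOp χ ((translationOp k : L2Haar K →L[ℂ] L2Haar K) f)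
  have h3 := coeFn_modulationOp χ f
  have h4 := (measurePreserving_mul_left (Measure.haar : Measure K)
    k⁻¹).quasiMeasurePreserving.ae_eq_comp h3
  have h5 := coeFn_translationOp k ((modulationOp χ : L2Haar K →L[ℂ] L2Haar K) f)
  have h6 := Lp.coeFn_smul (χ k : ℂ) ((translationOp k : L2Haar K →L[ℂ] L2Haar K)
    ((modulationOp χ : L2Haar K →L[ℂ] L2Haar K) f))
  refine h2.trans (EventuallyEq.symm (h6.trans ?_))
  filter_upwards [h1, h4, h5] with t e1 e4 e5
  simp only [Pi.smul_apply, smul_eq_mul, Function.comp_apply] at *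
  rw [e5, e4, e1, ← mul_assoc, ← Circle.coe_mul, ← map_mul, mul_inv_cancel_left]

/-- The operator `z L(k) M(χ)`, where `z = e^{2πit}` is a phase. -/
def heisenbergOp (z : Circle) (k : K) (χ : PontryaginDual K) :
    unitary (L2Haar K →L[ℂ] L2Haar K) :=
  scalarUnitary z * translationOp k * modulationOp χ

theorem heisenbergOp_mul (z w : Circle) (k l : K) (χ η : PontryaginDual K) :
    heisenbergOp z k χ * heisenbergOp w l η =
      heisenbergOp (z * w * χ l) (k * l) (χ * η) := by
  simp only [heisenbergOp, map_mul]
  calc _ = scalarUnitary z * translationOp k * (modulationOp χ * scalarUnitary w) *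
        translationOp l * modulationOp η := by simp only [mul_assoc]
    _ = scalarUnitary z * (translationOp k * scalarUnitary w) * (modulationOp χ *
        translationOp l) * modulationOp η := by
          rw [← scalarUnitary_comm]; simp only [mul_assoc]
    _ = scalarUnitary z * scalarUnitary w * (translationOp k * scalarUnitary (χ l)) *
        translationOp l * modulationOp χ * modulationOp η := by
          rw [modulationOp_mul_translationOp, ← scalarUnitary_comm w (translationOp k)]
          simp only [mul_assoc]
    _ = _ := by rw [← scalarUnitary_comm (χ l) (translationOp k)]; simp only [mul_assoc]

variable (K)

/-- The set of operators `e^{2πit} L(k) M(χ)` is a group of unitary operators on `L²(K)`. -/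
def heisenbergSubgroup : Subgroup (unitary (L2Haar K →L[ℂ] L2Haar K)) where
  carrier := {U | ∃ (z : Circle) (k : K) (χ : PontryaginDual K), U = heisenbergOp z k χ}
  mul_mem' := by
    rintro _ _ ⟨z, k, χ, rfl⟩ ⟨w, l, η, rfl⟩
    exact ⟨_, _, _, heisenbergOp_mul z w k l χ η⟩
  one_mem' := ⟨1, 1, 1, by simp [heisenbergOp]⟩
  inv_mem' := by
    rintro _ ⟨z, k, χ, rfl⟩
    refine ⟨z⁻¹ * χ k, k⁻¹, χ⁻¹, ?_⟩
    rw [inv_eq_iff_mul_eq_one, heisenbergOp_mul]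
    simp [heisenbergOp]

/-- The Heisenberg group `J` associated with `K`. -/
def HeisenbergGroup : Type _ := heisenbergSubgroup K

instance : Group (HeisenbergGroup K) := inferInstanceAs (Group (heisenbergSubgroup K))

variable {K}

/-- The element `z L(k) M(χ)` of the Heisenberg group. -/
def HeisenbergGroup.mk (z : Circle) (k : K) (χ : PontryaginDual K) : HeisenbergGroup K :=
  ⟨heisenbergOp z k χ, z, k, χ, rfl⟩

/-- The Lie group topology of `J`: that of the coordinates `(z, k, χ)`. -/
instance : TopologicalSpace (HeisenbergGroup K) :=
  TopologicalSpace.coinduced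
    (fun p : Circle × K × PontryaginDual K => HeisenbergGroup.mk p.1 p.2.1 p.2.2) inferInstance

end Heisenberg

/-- The Schrödinger map in coordinates, `(z, g, ĝ) ↦ z π(g) π'(ĝ)`, where `z = e^{2πit}`. -/
def schrodingerMap {H : Type*} [NormedAddCommGroup H] [InnerProductSpace ℂ H] [CompleteSpace H]
    {G : PhysicalQuantity} (π : G.Carrier →* unitary (H →L[ℂ] H))
    (π' : G.dual.Carrier →* unitary (H →L[ℂ] H)) (z : Circle) (g : G.Carrier)
    (g' : G.dual.Carrier) : unitary (H →L[ℂ] H) :=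
  scalarUnitary z * π g * π' g'

end

/-! Everything rests on one Weyl relation `π' g' * π g = χ_{g'}(g) (π g * π' g')`, obtained by
passing from the generator `T'` to the group `π'` that it generates. For `G = ℝ, ℤ` the dual is `ℝ`
or the circle, and `T'` is self-adjoint. Since `π(g)* T' π(g) = T' + g`, the orbits `V(t)Px` and
`e^{itg} P V(t)y`, with `P = π g` and `V` the group generated by `T'`, solve the same equation `u' =
iT'u`. Their inner product is therefore constant, which forces `V(t)P = e^{itg} P V(t)`
(`IsInfinitesimalGenerator.mul_eq_of_conjugate`); the characters are the standard ones. For `G =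
e^{iℝ}, e^{2πiℤ/N}`, `T'` is a unitary `U` generating `π'(Ĝ)`, and `U^n P = g^n P U^n`. The standard
generator of `Ĝ` acts as `U^k`, and `k` need not be `1`, so the characters are twisted by `k`. As
`U` itself lies in `π'(Ĝ)` and the phases `g` exhaust `G`, `k` is invertible, in `ℤ` or modulo `N`.
This gives bijectivity. The bijection is a homeomorphism by the open mapping theorem for σ-compact
groups. Finally, the phase, translation and modulation of an element of `J` are unique, because
commutators in `J` detect them (`heisenbergOp_eq_one_imp`). Hence the Schrödinger map is well
defined, and the Weyl relation makes it multiplicative. -/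

theorem coe_scalarUnitary_apply {H : Type*} [NormedAddCommGroup H] [InnerProductSpace ℂ H]
    [CompleteSpace H] (z : Circle) (f : H) :
    ((scalarUnitary z : unitary (H →L[ℂ] H)) : H →L[ℂ] H) f = (z : ℂ) • f := by
  simp [coe_scalarUnitary]

theorem scalarUnitary_injective {H : Type*} [NormedAddCommGroup H] [InnerProductSpace ℂ H]
    [CompleteSpace H] [Nontrivial H] :
    Function.Injective (scalarUnitary : Circle →* unitary (H →L[ℂ] H)) := by
  intro z w h
  obtain ⟨f, hf⟩ := exists_ne (0 : H)
  have h1 : (z : ℂ) • f = (w : ℂ) • f := by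
    rw [← coe_scalarUnitary_apply, ← coe_scalarUnitary_apply, h]
  exact Circle.ext (smul_left_injective ℂ hf h1)

/-! ### Uniqueness of coordinates in the Heisenberg group -/

section Heisenberg

variable {K : Type*} [CommGroup K] [TopologicalSpace K] [IsTopologicalGroup K]
  [LocallyCompactSpace K] [MeasurableSpace K] [BorelSpace K]

/-- The interior of a compact neighbourhood of `1` has positive finite Haar measure, so its
indicator is a nonzero vector. -/
theorem nontrivial_L2Haar : Nontrivial (L2Haar K) := by
  obtain ⟨C, hC, hC1⟩ := exists_compact_mem_nhds (1 : K)
  have hpos : (Measure.haar : Measure K) (interior C) ≠ 0 :=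
    (isOpen_interior.measure_pos _ ⟨1, mem_interior_iff_mem_nhds.2 hC1⟩).ne'
  have hfin : (Measure.haar : Measure K) (interior C) ≠ ∞ :=
    ((measure_mono interior_subset).trans_lt hC.measure_lt_top).ne
  refine ⟨indicatorConstLp 2 isOpen_interior.measurableSet hfin (1 : ℂ), 0, fun h => ?_⟩
  have h1 := norm_indicatorConstLp (p := 2) (μ := (Measure.haar : Measure K))
    (hs := isOpen_interior.measurableSet) (hμs := hfin) (c := (1 : ℂ)) (by simp) (by simp)
  rw [h, norm_zero, norm_one, one_mul, eq_comm] at h1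
  refine (Real.rpow_pos_of_pos ?_ _).ne' h1
  exact ENNReal.toReal_pos hpos hfin

/-- The identity commutes with every `heisenbergOp 1 l η`, and comparing phases of the two products
gives `η k = χ l` for all `l`, `η`. Taking `l = 1` kills `k` by separation of points; taking `η = 1`
kills `χ`. -/
theorem heisenbergOp_eq_one_imp (hsep : ∀ k : K, (∀ η : PontryaginDual K, η k = 1) → k = 1)
    {z : Circle} {k : K} {χ : PontryaginDual K} (h : heisenbergOp z k χ = 1) :
    z = 1 ∧ k = 1 ∧ χ = 1 := by
  have := nontrivial_L2Haar (K := K)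
  have key : ∀ (w : Circle) (l : K) (η : PontryaginDual K), η k = χ l := by
    intro w l η
    have h1 : heisenbergOp z k χ * heisenbergOp 1 l η =
        heisenbergOp 1 l η * heisenbergOp z k χ := by rw [h, one_mul, mul_one]
    rw [heisenbergOp_mul, heisenbergOp_mul, mul_comm l k, mul_comm η χ] at h1
    simp only [heisenbergOp] at h1
    have h2 := scalarUnitary_injective (mul_right_cancel (mul_right_cancel h1))
    rw [mul_one, one_mul] at h2
    exact (mul_left_cancel h2).symm
  have hk : k = 1 := hsep k fun η => by rw [key 1 1 η, map_one]
  have hχ : χ = 1 := PontryaginDual.ext fun l => by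
    rw [← key 1 l 1, PontryaginDual.one_apply, PontryaginDual.one_apply]
  subst hk hχ
  refine ⟨scalarUnitary_injective (H := L2Haar K) ?_, rfl, rfl⟩
  simpa [heisenbergOp] using h

theorem HeisenbergGroup.mk_mul (z w : Circle) (k l : K) (χ η : PontryaginDual K) :
    HeisenbergGroup.mk z k χ * HeisenbergGroup.mk w l η =
      HeisenbergGroup.mk (z * w * χ l) (k * l) (χ * η) :=
  Subtype.ext (heisenbergOp_mul z w k l χ η)

theorem HeisenbergGroup.exists_eq_mk (a : HeisenbergGroup K) :
    ∃ (z : Circle) (k : K) (χ : PontryaginDual K), a = HeisenbergGroup.mk z k χ := by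
  obtain ⟨_, z, k, χ, rfl⟩ := a
  exact ⟨z, k, χ, rfl⟩

theorem HeisenbergGroup.mk_injective
    (hsep : ∀ k : K, (∀ η : PontryaginDual K, η k = 1) → k = 1)
    {z w : Circle} {k l : K} {χ η : PontryaginDual K}
    (h : HeisenbergGroup.mk z k χ = HeisenbergGroup.mk w l η) : z = w ∧ k = l ∧ χ = η := by
  have h0 : heisenbergOp z k χ = heisenbergOp w l η := congrArg Subtype.val h
  -- The second factor is the inverse of `heisenbergOp w l η`; the phase `η l` compensates the one
  -- produced by the product law.
  have h1 : heisenbergOp z k χ * heisenbergOp (w⁻¹ * η l) l⁻¹ η⁻¹ = 1 := by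
    rw [h0, heisenbergOp_mul]
    simp [heisenbergOp]
  rw [heisenbergOp_mul] at h1
  obtain ⟨h2, h3, h4⟩ := heisenbergOp_eq_one_imp hsep h1
  rw [mul_inv_eq_one] at h3 h4
  subst h3 h4
  refine ⟨?_, rfl, rfl⟩
  rw [mul_assoc, mul_assoc, map_inv, mul_inv_cancel, mul_one, mul_inv_eq_one] at h2
  exact h2

end Heisenberg

/-! ### From a Weyl pair to the Schrödinger representation -/

section Schrodinger

variable {H : Type*} [NormedAddCommGroup H] [InnerProductSpace ℂ H] [CompleteSpace H]

theorem norm_coe_unitary_apply (U : unitary (H →L[ℂ] H)) (f : H) :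
    ‖(U : H →L[ℂ] H) f‖ = ‖f‖ :=
  (ContinuousLinearMap.norm_map_iff_adjoint_comp_self (U : H →L[ℂ] H)).2
    (Unitary.star_mul_self_of_mem U.2) f

/-- A strongly continuous unitary representation is jointly continuous. -/
theorem IsSCU.continuous_apply {X K : Type*} [TopologicalSpace X] [Group K] [TopologicalSpace K]
    {ρ : K →* unitary (H →L[ℂ] H)} (hρ : IsSCU ρ) {k : X → K} {f : X → H}
    (hk : Continuous k) (hf : Continuous f) :
    Continuous fun x => (ρ (k x) : H →L[ℂ] H) (f x) := by
  refine continuous_iff_continuousAt.2 fun x₀ => ?_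
  -- Unitaries are isometric, so the error from replacing `f x` by `f x₀` is uniformly small in the
  -- group variable.
  have h1 : Tendsto (fun x => (ρ (k x) : H →L[ℂ] H) (f x - f x₀)) (𝓝 x₀) (𝓝 0) := by
    rw [tendsto_zero_iff_norm_tendsto_zero]
    simp only [norm_coe_unitary_apply]
    rw [← tendsto_zero_iff_norm_tendsto_zero]
    exact tendsto_sub_nhds_zero_iff.2 (hf.tendsto x₀)
  have h2 := ((hρ (f x₀)).comp hk).tendsto x₀
  simpa [ContinuousAt, Function.comp_def] using h1.add h2

variable {K K' : Type*} [CommGroup K] [TopologicalSpace K] [CommGroup K']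

/-- The Weyl relation `π'(g') π(g) = χ_{g'}(g) π(g) π'(g')`. -/
def IsWeylPair (π : K →* unitary (H →L[ℂ] H)) (π' : K' →* unitary (H →L[ℂ] H))
    (χ : K' →* PontryaginDual K) : Prop :=
  ∀ g g', π' g' * π g = scalarUnitary (χ g' g) * (π g * π' g')

theorem IsWeylPair.commutator {π : K →* unitary (H →L[ℂ] H)} {π' : K' →* unitary (H →L[ℂ] H)}
    {χ : K' →* PontryaginDual K} (h : IsWeylPair π π' χ) (g : K) (g' : K') :
    star (π g : H →L[ℂ] H) * star (π' g' : H →L[ℂ] H) * (π g : H →L[ℂ] H) *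
      (π' g' : H →L[ℂ] H) = (starRingEnd ℂ) (χ g' g : ℂ) • (1 : H →L[ℂ] H) := by
  have h1 : (π g)⁻¹ * (π' g')⁻¹ * π g * π' g' = scalarUnitary (χ g' g)⁻¹ := by
    rw [map_inv, eq_inv_iff_mul_eq_one, ← scalarUnitary_comm, mul_assoc _ (π g), ← mul_assoc,
      scalarUnitary_comm, mul_assoc, ← h g g']
    group
  have h2 := congrArg (Subtype.val : unitary (H →L[ℂ] H) → H →L[ℂ] H) h1
  rw [coe_scalarUnitary, Circle.coe_inv_eq_conj] at h2
  exact h2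

variable [IsTopologicalGroup K] [LocallyCompactSpace K] [MeasurableSpace K] [BorelSpace K]
  [TopologicalSpace K']

/-- Moving `π' (e.symm η)` past `π l` costs exactly the phase `η l` that appears in
`HeisenbergGroup.mk_mul`, so the two product laws agree. -/
theorem IsWeylPair.exists_heisenberg_rep {π : K →* unitary (H →L[ℂ] H)}
    {π' : K' →* unitary (H →L[ℂ] H)} {χ : K' →* PontryaginDual K} (h : IsWeylPair π π' χ)
    (hsep : ∀ k : K, (∀ η : PontryaginDual K, η k = 1) → k = 1)
    (hπ : IsSCU π) (hπ' : IsSCU π') (e : K' ≃ₜ* PontryaginDual K) (he : ∀ g', e g' = χ g') :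
    ∃ ρ : HeisenbergGroup K →* unitary (H →L[ℂ] H), IsSCU ρ ∧
      ∀ (z : Circle) (g : K) (g' : K'),
        ρ (HeisenbergGroup.mk z g (e g')) = scalarUnitary z * π g * π' g' := by
  -- The choice of coordinates is harmless: injectivity of the parametrization makes `r` satisfy the
  -- intended formula at every `mk z k η`.
  choose cz ck cχ hc using HeisenbergGroup.exists_eq_mk (K := K)
  set r : HeisenbergGroup K → unitary (H →L[ℂ] H) := fun a =>
    scalarUnitary (cz a) * π (ck a) * π' (e.symm (cχ a)) with hr
  have hrmk : ∀ z k η, r (HeisenbergGroup.mk z k η) = scalarUnitary z * π k * π' (e.symm η) := by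
    intro z k η
    obtain ⟨h1, h2, h3⟩ := HeisenbergGroup.mk_injective hsep (hc (HeisenbergGroup.mk z k η))
    simp only [hr, ← h1, ← h2, ← h3]
  have hmul : ∀ a b, r (a * b) = r a * r b := by
    intro a b
    obtain ⟨z, k, η, rfl⟩ := a.exists_eq_mk
    obtain ⟨w, l, θ, rfl⟩ := b.exists_eq_mk
    rw [HeisenbergGroup.mk_mul, hrmk, hrmk, hrmk]
    have h1 := h l (e.symm η)
    rw [← he, ContinuousMulEquiv.apply_symm_apply] at h1
    calc _ = scalarUnitary z * scalarUnitary w * (scalarUnitary (η l) * π k) * π l *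
          π' (e.symm η) * π' (e.symm θ) := by simp only [map_mul, mul_assoc]
      _ = scalarUnitary z * (scalarUnitary w * π k) * (scalarUnitary (η l) * (π l *
          π' (e.symm η))) * π' (e.symm θ) := by
            rw [scalarUnitary_comm (η l) (π k)]; simp only [mul_assoc]
      _ = scalarUnitary z * π k * (scalarUnitary w * π' (e.symm η)) * π l * π' (e.symm θ) := by
            rw [scalarUnitary_comm w (π k), ← h1]; simp only [mul_assoc]
      _ = _ := by rw [scalarUnitary_comm w (π' _)]; simp only [mul_assoc]
  refine ⟨MonoidHom.mk' r hmul, fun f => ?_, fun z g g' => ?_⟩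
  · refine continuous_coinduced_dom.2 ?_
    have h1 : Continuous fun p : Circle × K × PontryaginDual K =>
        (p.1 : ℂ) • (π p.2.1 : H →L[ℂ] H) ((π' (e.symm p.2.2) : H →L[ℂ] H) f) :=
      (continuous_subtype_val.comp continuous_fst).smul
        (hπ.continuous_apply (continuous_fst.comp continuous_snd)
          (hπ'.continuous_apply (e.symm.continuous.comp (continuous_snd.comp continuous_snd))
            continuous_const))
    refine h1.congr fun p => ?_
    simp only [Function.comp_apply, MonoidHom.mk'_apply, hrmk]
    rw [← coe_scalarUnitary_apply]
    rfl
  · rw [MonoidHom.mk'_apply, hrmk, ContinuousMulEquiv.symm_apply_apply]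

/-- Continuity of the inverse of `χ` comes from the open mapping theorem: a continuous surjection
from the σ-compact group `K'` onto the dual is open. -/
theorem IsWeylPair.exists_schrodinger [IsTopologicalGroup K'] [SigmaCompactSpace K'] {π : K →* unitary (H →L[ℂ] H)}
    {π' : K' →* unitary (H →L[ℂ] H)} {χ : K' →* PontryaginDual K} (h : IsWeylPair π π' χ)
    (hχ : Continuous χ) (hbij : Function.Bijective χ)
    (hsep : ∀ k : K, (∀ η : PontryaginDual K, η k = 1) → k = 1)
    (hπ : IsSCU π) (hπ' : IsSCU π') :
    ∃ e : K' ≃ₜ* PontryaginDual K,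
      (∀ (g : K) (g' : K'),
        star (π g : H →L[ℂ] H) * star (π' g' : H →L[ℂ] H) * (π g : H →L[ℂ] H) *
          (π' g' : H →L[ℂ] H) = (starRingEnd ℂ) (e g' g : ℂ) • (1 : H →L[ℂ] H)) ∧
      ∃ ρ : HeisenbergGroup K →* unitary (H →L[ℂ] H), IsSCU ρ ∧
        ∀ (z : Circle) (g : K) (g' : K'),
          ρ (HeisenbergGroup.mk z g (e g')) = scalarUnitary z * π g * π' g' := by
  let e : K' ≃ₜ* PontryaginDual K :=
    { MulEquiv.ofBijective χ hbij,
      (Equiv.ofBijective χ hbij).toHomeomorphOfContinuousOpen hχ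
        (χ.isOpenMap_of_sigmaCompact hbij.2 hχ) with }
  exact ⟨e, h.commutator, h.exists_heisenberg_rep hsep hπ hπ' e fun _ => rfl⟩

end Schrodinger

/-! ### Weyl relations from covariance of the generator -/

section Operators

variable {H : Type*} [NormedAddCommGroup H] [InnerProductSpace ℂ H]

/-- On the zero space every number is a resolvent point, with `R = 0`. A nonzero space is what
allows a phase to be read off from a scalar operator. -/
theorem nontrivial_of_spec_nonempty {T : H →ₗ.[ℂ] H} (h : (spec T).Nonempty) : Nontrivial H := by
  obtain ⟨c, hc⟩ := h
  by_contra hn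
  rw [not_nontrivial_iff_subsingleton] at hn
  exact hc ⟨0, fun y => ⟨0, Subsingleton.elim _ _, Subsingleton.elim _ _⟩,
    fun x => Subsingleton.elim _ _⟩

variable [CompleteSpace H]

theorem IsSelfAdjoint.inner_apply_left {T : H →ₗ.[ℂ] H} (hT : IsSelfAdjoint T)
    (x y : T.domain) : inner ℂ (T x) (y : H) = inner ℂ (x : H) (T y) := by
  have h := LinearPMap.adjoint_isFormalAdjoint hT.dense_domain
  rw [LinearPMap.isSelfAdjoint_def.1 hT] at h
  exact h x y

/-- Every vector of the domain has a differentiable orbit, which stays in the domain. -/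
theorem IsInfinitesimalGenerator.orbit {T : H →ₗ.[ℂ] H} {V : ℝ → unitary (H →L[ℂ] H)}
    (hV : IsInfinitesimalGenerator T V) (hadd : ∀ s t, V (s + t) = V s * V t)
    (x : T.domain) (t : ℝ) : ∃ y : T.domain, (y : H) = (V t : H →L[ℂ] H) x ∧
      HasDerivAt (fun s => (V s : H →L[ℂ] H) x) (Complex.I • T y) t := by
  have h1 : HasDerivAt (fun s => (V s : H →L[ℂ] H) x) (Complex.I • T x) 0 :=
    (hV.2 x (T x)).1 ⟨x, rfl, rfl⟩
  have h2 : HasDerivAt (fun s => (V t : H →L[ℂ] H) ((V s : H →L[ℂ] H) x))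
      (Complex.I • (V t : H →L[ℂ] H) (T x)) 0 := by
    rw [← map_smul]
    exact ((V t : H →L[ℂ] H).restrictScalars ℝ).hasFDerivAt.comp_hasDerivAt 0 h1
  have hVts : ∀ s, (V t : H →L[ℂ] H) ((V s : H →L[ℂ] H) x) = (V (t + s) : H →L[ℂ] H) x :=
    fun s => by rw [hadd]; rfl
  have hVst : ∀ s, (V t : H →L[ℂ] H) ((V s : H →L[ℂ] H) x) =
      (V s : H →L[ℂ] H) ((V t : H →L[ℂ] H) x) :=
    fun s => by rw [hVts, add_comm, hadd]; rfl
  -- Since `V t` commutes with `V s`, the orbit of `V t x` is differentiable at `0`; hence `V t x`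
  -- is in the domain and `T (V t x) = V t (T x)`.
  obtain ⟨y, hy1, hy2⟩ := (hV.2 _ _).2 (h2.congr_of_eventuallyEq
    (Eventually.of_forall fun s => (hVst s).symm))
  refine ⟨y, hy1, ?_⟩
  rw [hy2]
  simp only [hVts] at h2
  have h3 : HasDerivAt (fun s => s - t) 1 t := (hasDerivAt_id t).sub_const t
  have h4 := h2.scomp_of_eq t h3 (by simp)
  simpa [Function.comp_def] using h4

/-- If `P* T P = T + a`, then the one-parameter group `V` generated by `T` satisfies
`V(t) P = e^{ita} P V(t)`. -/
theorem IsInfinitesimalGenerator.mul_eq_of_conjugate {T : H →ₗ.[ℂ] H}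
    {V : ℝ → unitary (H →L[ℂ] H)} (hV : IsInfinitesimalGenerator T V)
    (hadd : ∀ s t, V (s + t) = V s * V t) {P : unitary (H →L[ℂ] H)} {a : ℝ}
    (hP : conjugate P T = ((a : ℂ) • (LinearMap.id : H →ₗ[ℂ] H)) +ᵥ T) (t : ℝ) :
    V t * P = scalarUnitary (Circle.exp (t * a)) * (P * V t) := by
  -- Equality of domains makes `P` preserve `T.domain`, and there `T P = P (T + a)`.
  have hPT : ∀ x : T.domain, ∃ y : T.domain, (y : H) = (P : H →L[ℂ] H) x ∧
      T y = (P : H →L[ℂ] H) (T x) + (a : ℂ) • (P : H →L[ℂ] H) x := by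
    intro x
    have hx : (x : H) ∈ (conjugate P T).domain := by rw [hP]; exact x.2
    refine ⟨⟨(P : H →L[ℂ] H) x, hx⟩, rfl, ?_⟩
    have h1 : conjugate P T ⟨x, hx⟩ = (((a : ℂ) • (LinearMap.id : H →ₗ[ℂ] H)) +ᵥ T) x :=
      by obtain ⟨_, h0⟩ := LinearPMap.ext_iff.1 hP; exact @h0 x hx x.2
    have h2 : (star P : H →L[ℂ] H) (T ⟨(P : H →L[ℂ] H) x, hx⟩) = (a : ℂ) • (x : H) + T x := h1
    have h3 := congrArg (P : H →L[ℂ] H) h2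
    rw [← mul_apply_eq_comp, Unitary.mul_star_self_of_mem P.2,
      one_apply_eq_self] at h3
    rw [h3, map_add, map_smul, add_comm]
  have hV0 : V 0 = 1 := by simpa using hadd 0 0
  have hinner : ∀ x y : T.domain, inner ℂ ((V t : H →L[ℂ] H) ((P : H →L[ℂ] H) x))
      ((Circle.exp (t * a) : ℂ) • (P : H →L[ℂ] H) ((V t : H →L[ℂ] H) y)) =
        inner ℂ (x : H) (y : H) := by
    intro x y
    obtain ⟨px, hpx, -⟩ := hPT x
    set F : ℝ → ℂ := fun s => inner ℂ ((V s : H →L[ℂ] H) ((P : H →L[ℂ] H) x))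
      ((Circle.exp (s * a) : ℂ) • (P : H →L[ℂ] H) ((V s : H →L[ℂ] H) y)) with hF
    have hd : ∀ s, HasDerivAt F 0 s := by
      intro s
      obtain ⟨u, hu, hu'⟩ := hV.orbit hadd px s
      obtain ⟨v, hv, hv'⟩ := hV.orbit hadd y s
      obtain ⟨w, hw, hw'⟩ := hPT v
      have he : HasDerivAt (fun s : ℝ => (Circle.exp (s * a) : ℂ))
          (Circle.exp (s * a) * (a * Complex.I)) s := by
        simp only [Circle.coe_exp]
        have h1 : HasDerivAt (fun s : ℝ => ((s * a : ℝ) : ℂ) * Complex.I)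
            (a * Complex.I) s := by
          simpa using (((hasDerivAt_id s).mul_const a).ofReal_comp).mul_const Complex.I
        exact h1.cexp
      have h2 : HasDerivAt (fun s => (P : H →L[ℂ] H) ((V s : H →L[ℂ] H) y))
          ((P : H →L[ℂ] H) (Complex.I • T v)) s :=
        ((P : H →L[ℂ] H).restrictScalars ℝ).hasFDerivAt.comp_hasDerivAt s hv'
      have h3 := HasDerivAt.inner ℂ hu' (he.smul h2)
      rw [hpx] at h3 hu
      refine h3.congr_deriv ?_
      -- The phase contributes exactly the term `a` of `T P = P (T + a)`, so the second orbit also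
      -- solves `u' = iTu`. Symmetry of `T` then cancels the two terms of the derivative of the
      -- inner product.
      have h4 : (Circle.exp (s * a) : ℂ) • (P : H →L[ℂ] H) (Complex.I • T v) +
          ((Circle.exp (s * a) : ℂ) * (a * Complex.I)) •
            (P : H →L[ℂ] H) ((V s : H →L[ℂ] H) y) =
          (Circle.exp (s * a) : ℂ) • Complex.I • T w := by
        rw [hw', ← hv, map_smul]
        module
      rw [h4, ← hu]
      change inner ℂ (u : H) ((Circle.exp (s * a) : ℂ) • Complex.I • T w) +
        inner ℂ (Complex.I • T u) ((Circle.exp (s * a) : ℂ) •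
          (P : H →L[ℂ] H) ((V s : H →L[ℂ] H) y)) = 0
      rw [← hv, ← hw]
      simp only [inner_smul_left, inner_smul_right, hV.1.inner_apply_left, Complex.conj_I]
      ring
    have hconst := is_const_of_deriv_eq_zero (fun s => (hd s).differentiableAt)
      (fun s => (hd s).deriv) t 0
    change F t = _
    rw [hconst, hF]
    simp only [hV0, zero_mul, Circle.exp_zero, Circle.coe_one, one_smul]
    change inner ℂ ((P : H →L[ℂ] H) x) ((P : H →L[ℂ] H) y) = _
    rw [← ContinuousLinearMap.adjoint_inner_right, ← mul_apply_eq_comp,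
      ← ContinuousLinearMap.star_eq_adjoint, Unitary.star_mul_self_of_mem P.2,
      one_apply_eq_self]
  set A : H →L[ℂ] H := ((V t * P : unitary (H →L[ℂ] H)) : H →L[ℂ] H)
  set B : H →L[ℂ] H := ((scalarUnitary (Circle.exp (t * a)) * (P * V t) :
    unitary (H →L[ℂ] H)) : H →L[ℂ] H)
  have hBapp : ∀ y, B y = (Circle.exp (t * a) : ℂ) • (P : H →L[ℂ] H) ((V t : H →L[ℂ] H) y) :=
    fun y => coe_scalarUnitary_apply _ _
  -- The identity `⟨Ax, By⟩ = ⟨x, y⟩` extends from the dense domain, one variable at a time.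
  have hAB : star A * B = 1 := by
    have hx : ∀ x : T.domain, ∀ y : H, inner ℂ (A x) (B y) = inner ℂ (x : H) y := by
      intro x
      refine fun y => congrFun (Continuous.ext_on (f := fun y => inner ℂ (A x) (B y))
        (g := fun y => inner ℂ (x : H) y) hV.1.dense_domain (by fun_prop) (by fun_prop)
        fun y hy => ?_) y
      simp only [hBapp]
      exact hinner x ⟨y, hy⟩
    ext y
    refine ext_inner_left ℂ fun x => ?_
    rw [mul_apply_eq_comp, ContinuousLinearMap.star_eq_adjoint,
      ContinuousLinearMap.adjoint_inner_right, one_apply_eq_self]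
    exact congrFun (Continuous.ext_on (f := fun x => inner ℂ (A x) (B y))
        (g := fun x => inner ℂ x y) hV.1.dense_domain (by fun_prop) (by fun_prop)
        fun x hx' => hx ⟨x, hx'⟩ y) x
  have h5 : (V t * P)⁻¹ * (scalarUnitary (Circle.exp (t * a)) * (P * V t)) = 1 :=
    Subtype.ext hAB
  exact (inv_mul_eq_one.1 h5)

theorem mul_eq_of_conjugate_unitaryPMap {U P : unitary (H →L[ℂ] H)} {c : Circle}
    (h : conjugate P (unitaryPMap U) = (c : ℂ) • unitaryPMap U) :
    P⁻¹ * U * P = scalarUnitary c * U := by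
  ext x
  have h1 : conjugate P (unitaryPMap U) ⟨x, trivial⟩ = ((c : ℂ) • unitaryPMap U) ⟨x, trivial⟩ :=
    by obtain ⟨_, h0⟩ := LinearPMap.ext_iff.1 h; exact @h0 x trivial trivial
  exact h1.trans (coe_scalarUnitary_apply c _).symm

theorem zpow_mul_eq_of_conj {U P : unitary (H →L[ℂ] H)} {c : Circle}
    (h : P⁻¹ * U * P = scalarUnitary c * U) (n : ℤ) :
    U ^ n * P = scalarUnitary (c ^ n) * (P * U ^ n) := by
  have h1 := map_zpow (MulAut.conj P⁻¹) U n
  simp only [MulAut.conj_apply, inv_inv] at h1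
  rw [h, Commute.mul_zpow (scalarUnitary_comm c U), ← map_zpow] at h1
  rw [← mul_assoc, scalarUnitary_comm, mul_assoc, ← h1]
  group

/-- Conjugation by `P` turns `U ^ n = 1` into `c ^ n = 1`, so relations satisfied by `U` are
inherited by every phase that occurs. -/
theorem zpow_eq_one_of_conj [Nontrivial H] {U P : unitary (H →L[ℂ] H)} {c : Circle}
    (h : P⁻¹ * U * P = scalarUnitary c * U) {n : ℤ} (hn : U ^ n = 1) : c ^ n = 1 := by
  have h1 := zpow_mul_eq_of_conj h n
  rw [hn, one_mul, mul_one] at h1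
  refine (scalarUnitary_injective (H := H) (mul_right_cancel (b := P) ?_)).symm
  rw [← h1, map_one, one_mul]

/-- On a nonzero space the commutation relation determines the phase, so `g' ↦ η` is automatically
multiplicative. -/
theorem exists_isWeylPair_of_forall_exists [Nontrivial H] {K K' : Type*} [CommGroup K]
    [TopologicalSpace K] [CommGroup K'] {π : K →* unitary (H →L[ℂ] H)}
    {π' : K' →* unitary (H →L[ℂ] H)}
    (h : ∀ g', ∃ η : PontryaginDual K, ∀ g,
      π' g' * π g = scalarUnitary (η g) * (π g * π' g')) :
    ∃ χ : K' →* PontryaginDual K, IsWeylPair π π' χ := by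
  choose χ hχ using h
  refine ⟨MonoidHom.mk' χ fun a b => PontryaginDual.ext fun g => ?_, fun g g' => hχ g' g⟩
  refine scalarUnitary_injective (H := H) (mul_right_cancel (b := π g * π' (a * b)) ?_)
  change _ = scalarUnitary (χ a g * χ b g) * _
  rw [← hχ, map_mul, map_mul, mul_assoc, hχ b g]
  calc _ = π' a * scalarUnitary (χ b g) * π g * π' b := by simp only [mul_assoc]
    _ = scalarUnitary (χ b g) * (π' a * π g) * π' b := by
      rw [← scalarUnitary_comm]; simp only [mul_assoc]
    _ = scalarUnitary (χ b g) * scalarUnitary (χ a g) * (π g * (π' a * π' b)) := by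
      rw [hχ a g]; simp only [mul_assoc]
    _ = _ := by rw [← map_mul, ← map_mul, ← map_mul, mul_comm (χ b g)]

theorem IsWeylPair.unique [Nontrivial H] {K K' : Type*} [CommGroup K]
    [TopologicalSpace K] [CommGroup K'] {π : K →* unitary (H →L[ℂ] H)}
    {π' : K' →* unitary (H →L[ℂ] H)} {χ : K' →* PontryaginDual K} (h : IsWeylPair π π' χ)
    {g : K} {g' : K'} {c : Circle} (hc : π' g' * π g = scalarUnitary c * (π g * π' g')) :
    χ g' g = c :=
  scalarUnitary_injective (H := H) (mul_right_cancel ((h g g').symm.trans hc))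

end Operators

/-! ### Characters of the line, the circle and the integers -/

section Characters

/-- The character `x ↦ e^{isx}` of `ℝ`, as a homomorphism in `s`. -/
noncomputable def realCharacter : Multiplicative ℝ →* PontryaginDual (Multiplicative ℝ) :=
  MonoidHom.mk' (fun s =>
    (⟨MonoidHom.mk' (fun x => Circle.exp (s.toAdd * x.toAdd)) fun x y => by
        rw [toAdd_mul, mul_add, Circle.exp_add],
      Circle.exp.continuous.comp (continuous_const.mul continuous_toAdd)⟩ :
      Multiplicative ℝ →ₜ* Circle))
    fun s t => PontryaginDual.ext fun x => by
      change Circle.exp _ = Circle.exp _ * Circle.exp _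
      rw [← Circle.exp_add, toAdd_mul, add_mul]

theorem realCharacter_apply (s x : Multiplicative ℝ) :
    realCharacter s x = Circle.exp (s.toAdd * x.toAdd) := rfl

theorem continuous_realCharacter : Continuous realCharacter :=
  ContinuousMonoidHom.continuous_of_continuous_uncurry _
    (Circle.exp.continuous.comp
      ((continuous_toAdd.comp continuous_fst).mul (continuous_toAdd.comp continuous_snd)))

theorem eq_one_of_forall_realCharacter {x : Multiplicative ℝ} (h : ∀ s, realCharacter s x = 1) :
    x = 1 := by
  by_contra hx
  have hx0 : x.toAdd ≠ 0 := fun h0 => hx (toAdd_eq_zero.1 h0)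
  have h1 := h (Multiplicative.ofAdd (Real.pi / x.toAdd))
  rw [realCharacter_apply, toAdd_ofAdd, div_mul_cancel₀ _ hx0] at h1
  exact Circle.exp_pi_ne_one h1

/-- A continuous one-parameter group in the circle is an exponential. -/
theorem exists_eq_circle_exp_mul {f : ℝ → Circle} (hf : Continuous f)
    (hadd : ∀ x y, f (x + y) = f x * f y) : ∃ s : ℝ, ∀ x, f x = Circle.exp (s * x) := by
  have h0 : f 0 = 1 := by simpa using hadd 0 0
  -- Lift `f` through the covering `Circle.exp`, normalized by `F 0 = 0`.
  obtain ⟨F, ⟨hF0, hF⟩, -⟩ := Circle.isCoveringMap_exp.existsUnique_continuousMap_lifts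
    ⟨f, hf⟩ 0 0 (by simp [h0])
  replace hF : ∀ x, Circle.exp (F x) = f x := fun x => congrFun hF x
  have hFadd : ∀ x y, F (x + y) = F x + F y := by
    intro x y
    -- For fixed `x`, both sides lift the same map of `y` and agree at `y = 0`; uniqueness of lifts
    -- makes `F` additive, hence linear by continuity.
    refine congrFun (Circle.isCoveringMap_exp.eq_of_comp_eq (g₁ := fun y => F (x + y))
      (g₂ := fun y => F x + F y) (by fun_prop) (by fun_prop) ?_ 0 (by simp [hF0])) y
    funext y
    simp [hF, hadd, Circle.exp_add]
  let L := (AddMonoidHom.mk' F hFadd).toRealLinearMap F.continuous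
  refine ⟨F 1, fun x => ?_⟩
  have h1 : L (x • (1 : ℝ)) = x • L 1 := map_smul L x 1
  rw [smul_eq_mul, smul_eq_mul, mul_one] at h1
  rw [← hF, mul_comm]
  exact congrArg Circle.exp h1

theorem bijective_realCharacter : Function.Bijective realCharacter := by
  refine ⟨(injective_iff_map_eq_one _).2 fun s hs => ?_, fun φ => ?_⟩
  · refine eq_one_of_forall_realCharacter fun x => ?_
    rw [realCharacter_apply, mul_comm, ← realCharacter_apply, hs, PontryaginDual.one_apply]
  · obtain ⟨s, hs⟩ := exists_eq_circle_exp_mul (f := fun x => φ (Multiplicative.ofAdd x))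
      ((map_continuous φ).comp continuous_ofAdd) fun x y => by rw [ofAdd_add, map_mul]
    exact ⟨Multiplicative.ofAdd s, PontryaginDual.ext fun x => (hs x.toAdd).symm⟩

theorem eq_zero_of_forall_circle_zpow_eq_one {n : ℤ} (h : ∀ z : Circle, z ^ n = 1) : n = 0 := by
  by_contra hn
  have h1 := h (Circle.exp (Real.pi / n))
  rw [← Circle.exp_intCast_mul, mul_div_cancel₀ _ (Int.cast_ne_zero.2 hn)] at h1
  exact Circle.exp_pi_ne_one h1

/-- The inclusion of a subgroup of the circle, as a character. -/
noncomputable def circleInclusion (S : Subgroup Circle) : PontryaginDual S :=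
  (⟨S.subtype, continuous_subtype_val⟩ : S →ₜ* Circle)

theorem zpow_pontryaginDual_apply {K : Type*} [CommGroup K] [TopologicalSpace K]
    (η : PontryaginDual K) (n : ℤ) (x : K) : (η ^ n) x = η x ^ n :=
  map_zpow (MonoidHom.mk' (fun η : PontryaginDual K => η x) fun _ _ => rfl) η n

/-- The identity character of the circle. -/
noncomputable def circleIdentity : PontryaginDual Circle := ContinuousMonoidHom.id Circle

theorem exists_eq_circleIdentity_zpow (φ : PontryaginDual Circle) :
    ∃ n : ℤ, φ = circleIdentity ^ n := by
  obtain ⟨s, hs⟩ := exists_eq_circle_exp_mul (f := fun x => φ (Circle.exp x))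
    ((map_continuous φ).comp Circle.exp.continuous) fun x y => by rw [Circle.exp_add, map_mul]
  -- Periodicity forces the frequency `s` to be an integer.
  have h1 := hs (2 * Real.pi)
  rw [Circle.exp_two_pi, map_one, eq_comm, Circle.exp_eq_one] at h1
  obtain ⟨n, hn⟩ := h1
  have hsn : s = n := mul_right_cancel₀ Real.two_pi_pos.ne' hn
  refine ⟨n, PontryaginDual.ext fun z => ?_⟩
  obtain ⟨x, rfl⟩ := Circle.exp_surjective z
  rw [hs, hsn, Circle.exp_intCast_mul, zpow_pontryaginDual_apply]
  rfl

/-- The character `n ↦ z^n` of `ℤ`, as a homomorphism in `z`. -/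
noncomputable def intCharacter : Circle →* PontryaginDual (Multiplicative ℤ) :=
  MonoidHom.mk' (fun z =>
    (⟨zpowersHom Circle z, continuous_of_discreteTopology⟩ : Multiplicative ℤ →ₜ* Circle))
    fun z w => PontryaginDual.ext fun n => mul_zpow z w n.toAdd

theorem intCharacter_apply (z : Circle) (n : Multiplicative ℤ) :
    intCharacter z n = z ^ n.toAdd := rfl

theorem continuous_intCharacter : Continuous intCharacter :=
  ContinuousMonoidHom.continuous_of_continuous_uncurry _
    (continuous_prod_of_discrete_right.2 fun n => continuous_zpow n.toAdd)

theorem bijective_intCharacter : Function.Bijective intCharacter := by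
  refine ⟨fun z w h => ?_, fun φ => ⟨φ (Multiplicative.ofAdd 1), PontryaginDual.ext fun n => ?_⟩⟩
  · simpa [intCharacter_apply] using DFunLike.congr_fun h (Multiplicative.ofAdd (1 : ℤ))
  · rw [intCharacter_apply, ← map_zpow, ← ofAdd_zsmul]
    simp

theorem eq_one_of_forall_intCharacter {n : Multiplicative ℤ} (h : ∀ z, intCharacter z n = 1) :
    n = 1 :=
  toAdd_eq_zero.1 (eq_zero_of_forall_circle_zpow_eq_one h)

end Characters

/-! ### The four physical quantities -/

section Cases

variable {H : Type*} [NormedAddCommGroup H] [InnerProductSpace ℂ H] [CompleteSpace H]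
  {T : H →ₗ.[ℂ] H}

theorem isWeylPair_realCharacter {π π' : Multiplicative ℝ →* unitary (H →L[ℂ] H)}
    (hgen : IsInfinitesimalGenerator T fun t => π' (Multiplicative.ofAdd t))
    (hcan : ∀ g : Multiplicative ℝ,
      conjugate (π g) T = ((g.toAdd : ℂ) • (LinearMap.id : H →ₗ[ℂ] H)) +ᵥ T) :
    IsWeylPair π π' realCharacter := fun g g' =>
  hgen.mul_eq_of_conjugate (fun s t => by rw [ofAdd_add, map_mul]) (hcan g) g'.toAdd

theorem isWeylPair_intCharacter {π : Multiplicative ℤ →* unitary (H →L[ℂ] H)}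
    {π' : Circle →* unitary (H →L[ℂ] H)}
    (hgen : IsInfinitesimalGenerator T fun t => π' (Circle.exp t))
    (hcan : ∀ g : Multiplicative ℤ,
      conjugate (π g) T = ((g.toAdd : ℂ) • (LinearMap.id : H →ₗ[ℂ] H)) +ᵥ T) :
    IsWeylPair π π' intCharacter := by
  intro g z
  obtain ⟨t, rfl⟩ := Circle.exp_surjective z
  have h := hgen.mul_eq_of_conjugate (fun s t => by rw [Circle.exp_add, map_mul])
    (a := (g.toAdd : ℝ)) (by rw [hcan g]; simp) t
  rwa [mul_comm t, Circle.exp_intCast_mul] at h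

/-- With `U = π' a` and `π' 1 = U ^ k`, one has `U ^ (k * a - 1) = 1`. All unit phases occur, so `k
* a = 1`: thus `k = ±1`, and `n` acts by the character `z ↦ z ^ (k * n)`. -/
theorem exists_isWeylPair_circle [Nontrivial H] {π : Circle →* unitary (H →L[ℂ] H)}
    {π' : Multiplicative ℤ →* unitary (H →L[ℂ] H)} (hgen : IsUnitaryGenerator T π')
    (hcan : ∀ g : Circle, conjugate (π g) T = (g : ℂ) • T) :
    ∃ χ : Multiplicative ℤ →* PontryaginDual Circle,
      Function.Bijective χ ∧ IsWeylPair π π' χ := by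
  obtain ⟨U, rfl, hU⟩ := hgen
  have hconj := fun g => mul_eq_of_conjugate_unitaryPMap (hcan g)
  obtain ⟨a, ha⟩ : U ∈ π'.range := hU ▸ Subgroup.mem_zpowers U
  obtain ⟨k, hk⟩ : π' (Multiplicative.ofAdd 1) ∈ Subgroup.zpowers U := hU ▸ ⟨_, rfl⟩
  have hk' : ∀ n : Multiplicative ℤ, π' n = U ^ (k * n.toAdd) := by
    intro n
    rw [zpow_mul]
    change _ = (fun k : ℤ => U ^ k) k ^ _
    rw [hk, ← map_zpow, ← ofAdd_zsmul]
    simp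
  have hka : k * a.toAdd = 1 := by
    have h1 : U ^ (k * a.toAdd - 1) = 1 := by rw [zpow_sub_one, ← hk', ha, mul_inv_cancel]
    exact sub_eq_zero.1
      (eq_zero_of_forall_circle_zpow_eq_one fun z => zpow_eq_one_of_conj (hconj z) h1)
  have happ : ∀ (n : Multiplicative ℤ) (z : Circle),
      zpowersHom (PontryaginDual Circle) (circleIdentity ^ k) n z = z ^ (k * n.toAdd) := by
    intro n z
    rw [zpowersHom_apply, ← zpow_mul, zpow_pontryaginDual_apply]
    rfl
  refine ⟨zpowersHom _ (circleIdentity ^ k), ⟨(injective_iff_map_eq_one _).2 fun n hn => ?_,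
    fun φ => ?_⟩, fun g n => ?_⟩
  · have h1 := eq_zero_of_forall_circle_zpow_eq_one (n := k * n.toAdd) fun z => by
      rw [← happ, hn, PontryaginDual.one_apply]
    exact toAdd_eq_zero.1 ((mul_eq_zero.1 h1).resolve_left (left_ne_zero_of_mul_eq_one hka))
  · obtain ⟨m, rfl⟩ := exists_eq_circleIdentity_zpow φ
    refine ⟨Multiplicative.ofAdd (a.toAdd * m), ?_⟩
    rw [zpowersHom_apply, ← zpow_mul, toAdd_ofAdd, ← mul_assoc, hka, one_mul]
  · rw [happ, hk' n]
    exact zpow_mul_eq_of_conj (hconj g) _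

/-- This is the circle argument modulo the order of `ζ`: from `π' e = U ^ k` and `U = π' (e ^ l)` it
follows that `ζ ^ (k * l) = ζ`, so `k` and `l` are mutually inverse exponents. -/
theorem exists_isWeylPair_zpowers [Nontrivial H] {ζ : Circle} (hζ : IsOfFinOrder ζ)
    {π π' : Subgroup.zpowers ζ →* unitary (H →L[ℂ] H)} (hgen : IsUnitaryGenerator T π')
    (hcan : ∀ g : Subgroup.zpowers ζ, conjugate (π g) T = ((g : Circle) : ℂ) • T) :
    ∃ χ : Subgroup.zpowers ζ →* PontryaginDual (Subgroup.zpowers ζ),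
      Function.Bijective χ ∧ IsWeylPair π π' χ := by
  obtain ⟨U, rfl, hU⟩ := hgen
  have hconj := fun g => mul_eq_of_conjugate_unitaryPMap (hcan g)
  set e : Subgroup.zpowers ζ := ⟨ζ, Subgroup.mem_zpowers ζ⟩
  have hgene : ∀ g : Subgroup.zpowers ζ, ∃ i : ℤ, g = e ^ i := by
    rintro ⟨_, i, rfl⟩
    exact ⟨i, rfl⟩
  obtain ⟨b, hb⟩ : U ∈ π'.range := hU ▸ Subgroup.mem_zpowers U
  obtain ⟨l, rfl⟩ := hgene b
  obtain ⟨k, hk⟩ : π' e ∈ Subgroup.zpowers U := hU ▸ ⟨_, rfl⟩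
  have hk' : ∀ i : ℤ, π' (e ^ i) = U ^ (k * i) := by
    intro i
    rw [map_zpow, zpow_mul]
    exact congrArg (· ^ i) hk.symm
  have hkl : ζ ^ (k * l) = ζ := by
    have h1 : U ^ (k * l - 1) = 1 := by rw [zpow_sub_one, ← hk', hb, mul_inv_cancel]
    have h2 := zpow_eq_one_of_conj (hconj e) h1
    rwa [zpow_sub_one, mul_inv_eq_one] at h2
  have hrel : ∀ (i : ℤ) (g : Subgroup.zpowers ζ), π' (e ^ i) * π g =
      scalarUnitary ((g : Circle) ^ (k * i)) * (π g * π' (e ^ i)) := by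
    intro i g
    rw [hk']
    exact zpow_mul_eq_of_conj (hconj g) _
  -- The exponent `i` of `g'` is not unique; fixing the character through the commutation relation
  -- avoids a separate proof of well-definedness.
  obtain ⟨χ, hχ⟩ := exists_isWeylPair_of_forall_exists (π := π) (π' := π') fun g' => by
    obtain ⟨i, rfl⟩ := hgene g'
    refine ⟨circleInclusion _ ^ (k * i), fun g => ?_⟩
    rw [hrel i g, zpow_pontryaginDual_apply]
    rfl
  have happ : ∀ i : ℤ, χ (e ^ i) e = ζ ^ (k * i) := fun i => hχ.unique (hrel i e)
  refine ⟨χ, ⟨(injective_iff_map_eq_one _).2 fun g' hg' => ?_, fun φ => ?_⟩, hχ⟩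
  · obtain ⟨i, rfl⟩ := hgene g'
    have h1 := happ i
    rw [hg', PontryaginDual.one_apply] at h1
    refine Subtype.ext ?_
    change ζ ^ i = 1
    rw [← hkl, ← zpow_mul, mul_right_comm, zpow_mul, ← h1, one_zpow]
  -- The value `φ e` is a root of unity of order dividing that of `ζ`, hence a power `ζ ^ i`, and
  -- `φ` is determined by it.
  · have hprim : IsPrimitiveRoot (ζ : ℂ) (orderOf ζ) :=
      (IsPrimitiveRoot.orderOf ζ).map_of_injective (f := Circle.coeHom) Circle.coe_injective
    have hφ : ((φ e : Circle) : ℂ) ^ orderOf ζ = 1 := by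
      have h1 : e ^ orderOf ζ = 1 := Subtype.ext (pow_orderOf_eq_one ζ)
      rw [← Circle.coe_pow, ← map_pow, h1, map_one, Circle.coe_one]
    have : NeZero (orderOf ζ) := ⟨hζ.orderOf_pos.ne'⟩
    obtain ⟨i, -, hi⟩ := hprim.eq_pow_of_pow_eq_one hφ
    have hi' : ζ ^ i = φ e := Circle.ext hi
    -- The factor `l` undoes the twist: `χ (e ^ (l * i)) e = ζ ^ (k * l * i) = ζ ^ i`.
    refine ⟨e ^ (l * (i : ℤ)), PontryaginDual.ext fun g => ?_⟩
    obtain ⟨j, rfl⟩ := hgene g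
    rw [map_zpow (χ _), map_zpow φ, happ, ← mul_assoc, zpow_mul, hkl, zpow_natCast, hi']

end Cases

/-! ### σ-compactness, separation of points, and the proposition -/

section Quantities

theorem isOfFinOrder_circle_exp (N : ℕ+) : IsOfFinOrder (Circle.exp (2 * Real.pi / N)) := by
  refine isOfFinOrder_iff_pow_eq_one.2 ⟨N, N.pos, ?_⟩
  have hN : ((N : ℕ) : ℝ) ≠ 0 := by exact_mod_cast N.ne_zero
  rw [← Circle.exp_natCast_mul, mul_div_cancel₀ _ hN, Circle.exp_two_pi]

theorem finite_zpowers_circle_exp (N : ℕ+) :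
    Finite (Subgroup.zpowers (Circle.exp (2 * Real.pi / N))) :=
  (isOfFinOrder_circle_exp N).finite_zpowers

theorem PhysicalQuantity.sigmaCompactSpace_carrier :
    (G : PhysicalQuantity) → SigmaCompactSpace G.Carrier
  | .real => inferInstanceAs (SigmaCompactSpace (Multiplicative ℝ))
  | .circle => inferInstanceAs (SigmaCompactSpace Circle)
  | .int => inferInstanceAs (SigmaCompactSpace (Multiplicative ℤ))
  | .roots N => by
    have := finite_zpowers_circle_exp N
    exact inferInstanceAs (SigmaCompactSpace (Subgroup.zpowers (Circle.exp (2 * Real.pi / N))))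

theorem PhysicalQuantity.eq_one_of_forall_character :
    (G : PhysicalQuantity) → ∀ k : G.Carrier, (∀ η : PontryaginDual G.Carrier, η k = 1) → k = 1
  | .real => fun _ h => eq_one_of_forall_realCharacter fun s => h (realCharacter s)
  | .circle => fun _ h => h circleIdentity
  | .int => fun _ h => eq_one_of_forall_intCharacter fun z => h (intCharacter z)
  | .roots _ => fun _ h => Subtype.ext (h (circleInclusion _))

end Quantities

theorem IsCanonicalSystem.exists_isWeylPair {H : Type*} [NormedAddCommGroup H]
    [InnerProductSpace ℂ H] [CompleteSpace H] {G : PhysicalQuantity}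
    {π : G.Carrier →* unitary (H →L[ℂ] H)} {T : H →ₗ.[ℂ] H}
    {π' : G.dual.Carrier →* unitary (H →L[ℂ] H)} {T' : H →ₗ.[ℂ] H}
    (hsys : IsCanonicalSystem G π T π' T') :
    ∃ χ : G.dual.Carrier →* PontryaginDual G.Carrier,
      Continuous χ ∧ Function.Bijective χ ∧ IsWeylPair π π' χ := by
  have : Nontrivial H :=
    nontrivial_of_spec_nonempty (T := T') (hsys.spec_dual ▸ ⟨_, 1, rfl⟩)
  have hgen := hsys.generator_dual
  have hcan := hsys.canonical.2
  cases G with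
  | real =>
    exact ⟨realCharacter, continuous_realCharacter, bijective_realCharacter,
      isWeylPair_realCharacter hgen hcan⟩
  | circle =>
    obtain ⟨χ, h1, h2⟩ := exists_isWeylPair_circle hgen hcan
    -- The dual of the circle is discrete, so continuity is automatic whatever the twist.
    exact ⟨χ, continuous_of_discreteTopology (α := Multiplicative ℤ), h1, h2⟩
  | int =>
    exact ⟨intCharacter, continuous_intCharacter, bijective_intCharacter,
      isWeylPair_intCharacter hgen hcan⟩
  | roots N =>
    have := finite_zpowers_circle_exp N
    obtain ⟨χ, h1, h2⟩ := exists_isWeylPair_zpowers (isOfFinOrder_circle_exp N) hgen hcan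
    exact ⟨χ, continuous_of_discreteTopology
      (α := Subgroup.zpowers (Circle.exp (2 * Real.pi / N))), h1, h2⟩

theorem mainTheorem9 {H : Type*} [NormedAddCommGroup H] [InnerProductSpace ℂ H] [CompleteSpace H]
    [TopologicalSpace.SeparableSpace H]
    (G : PhysicalQuantity) (π : G.Carrier →* unitary (H →L[ℂ] H)) (T : H →ₗ.[ℂ] H)
    (π' : G.dual.Carrier →* unitary (H →L[ℂ] H)) (T' : H →ₗ.[ℂ] H)
    (hsys : IsCanonicalSystem G π T π' T') :
    ∃ χ : G.dual.Carrier ≃ₜ* PontryaginDual G.Carrier,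
      (∀ (g : G.Carrier) (g' : G.dual.Carrier),
        star (π g : H →L[ℂ] H) * star (π' g' : H →L[ℂ] H) * (π g : H →L[ℂ] H) *
          (π' g' : H →L[ℂ] H) = (starRingEnd ℂ) (χ g' g : ℂ) • (1 : H →L[ℂ] H)) ∧
      ∃ ρ : HeisenbergGroup G.Carrier →* unitary (H →L[ℂ] H),
        IsSCU ρ ∧
        ∀ (z : Circle) (g : G.Carrier) (g' : G.dual.Carrier),
          ρ (HeisenbergGroup.mk z g (χ g')) = schrodingerMap π π' z g g' := by
  have := G.dual.sigmaCompactSpace_carrier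
  obtain ⟨χ, hχ, hbij, h⟩ := hsys.exists_isWeylPair
  exact h.exists_schrodinger hχ hbij G.eq_one_of_forall_character hsys.scu hsys.scu_dual
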